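/- Let $\mathcal X$ be a non-empty set with a $\sigma$-algebra, let $\Delta(\mathcal X)$ be the set of probability measures on $\mathcal X$, and let $\mathcal D\subseteq\{0,1\}^{\mathcal X}$ be a class of measurable functions (with the power set of $\mathcal X$ as $\sigma$-algebra, $\mathcal D$ may be any class). For $p\in\Delta(\mathcal X)$ write $p(d)=\mathbb E_{x\sim p}[d(x)]$, and for $p,q\in\Delta(\mathcal X)$ let $\mathrm{IPM}_{\mathcal D}(p,q)=\sup_{d\in\mathcal D}|p(d)-q(d)|$ (which is $0$ if $\mathcal D=\emptyset$). For $\epsilon>0$ consider the following game between a deterministic generator $G$ and a deterministic discriminator $D$, who both know $\mathcal D$ and $\epsilon$. The discriminator $D$ receives a target distribution $p_{real}\in\Delta(\mathcal X)$, which $G$ does not see. In round $t$ the generator submits $p_t\in\Delta(\mathcal X)$, depending only on the replies received so far. If $\mathrm{IPM}_{\mathcal D}(p_t,p_{real})\le\epsilon$, then $D$ replies "WIN" and the game terminates, won by $G$; otherwise $D$ replies with some $d_t\in\mathcal D\cup(1-\mathcal D)$ such that $p_{real}(d_t)-p_t(d_t)>\epsilon$. The class $\mathcal D$ is \emph{$\epsilon$-Sequential-foolable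 within $T$ rounds} if there is a generator that wins against every discriminator with every target distribution $p_{real}$ after at most $T$ rounds; it is \emph{$\epsilon$-Sequential-foolable} if this holds for some $T\in\mathbb N$; and it is \emph{Sequential-foolable} if there is a polynomial $P$ such that for every $\epsilon>0$ it is $\epsilon$-Sequential-foolable within some number $T(\epsilon)\le P(1/\epsilon)$ of rounds. The \emph{Littlestone dimension} of a class $\mathcal H\subseteq\{0,1\}^{\mathcal W}$ is the supremum of all $n$ for which there is a complete binary tree of depth $n$, with internal nodes labelled by elements of $\mathcal W$, that is shattered by $\mathcal H$: for every root-to-leaf path there is $h\in\mathcal H$ such that, for every internal node on the path, with label $w$, $h(w)=1$ if the path continues to the right child of that node and $h(w)=0$ if it continues to the left child. (The Littlestone dimension of the empty class is $0$.) The \emph{dual Littlestone dimension} of $\mathcal D$ is the Littlestone dimension of the dual class $\{d\mapsto d(x) : x\in\mathcal X\}\subseteq\{0,1\}^{\mathcal D}$. \textbf{Theorem.} The following are equivalent: 1. $\mathcal D$ is Sequential-foolable. 2. $\mathcal D$ is $\epsilon$-Sequential-foolable for some $0<\epsilon<1/2$. 3. $\mathcal D$ has finite dual Littlestone dimension. 4.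 $\mathcal D$ has finite Littlestone dimension. -/

import Mathlib

open MeasureTheory

/-! ### Littlestone dimension -/

/-- Complete binary trees of depth `n` whose internal nodes are labelled by elements of `W`. -/
inductive MistakeTree (W : Type*) : ℕ → Type _
  | leaf : MistakeTree W 0
  | node {n : ℕ} (w : W) (left right : MistakeTree W n) : MistakeTree W (n + 1)

/-- The root-to-leaf paths of a mistake tree, as sequences of examples `(w₁, y₁), …, (wₙ, yₙ)`:
`wᵢ` is the label of the `i`-th internal node on the path, and `yᵢ` is `true` (that is, `1`)
if the path continues to the right child of that node and `false` (that is, `0`) otherwise. -/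
def MistakeTree.paths {W : Type*} : {n : ℕ} → MistakeTree W n → Set (List (W × Bool))
  | _, .leaf => {[]}
  | _, .node w left right =>
      (fun s => (w, false) :: s) '' left.paths ∪ (fun s => (w, true) :: s) '' right.paths

/-- The tree `t` is shattered by the class `H`: every root-to-leaf path is realized by some
hypothesis in `H`. -/
def MistakeTree.ShatteredBy {W : Type*} {n : ℕ} (t : MistakeTree W n) (H : Set (W → Bool)) : Prop :=
  ∀ s ∈ t.paths, ∃ h ∈ H, ∀ e ∈ s, h e.1 = e.2

/-- The Littlestone dimension: the supremum of the depths of the complete trees shattered by `H`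
(`⊤` if there are shattered trees of arbitrarily large depth; `0` for the empty class). -/
noncomputable def littlestoneDim {W : Type*} (H : Set (W → Bool)) : ℕ∞ :=
  ⨆ (n : ℕ) (_ : ∃ t : MistakeTree W n, t.ShatteredBy H), (n : ℕ∞)

/-- The dual class of `D ⊆ {0,1}^X`: the functions `d ↦ d x` on `D`, for `x` in `X`. -/
def dualClass {X : Type*} (D : Set (X → Bool)) : Set (D → Bool) :=
  Set.range fun (x : X) (d : D) => d.1 x

/-- The dual Littlestone dimension. -/
noncomputable def dualLittlestoneDim {X : Type*} (D : Set (X → Bool)) : ℕ∞ :=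
  littlestoneDim (dualClass D)

/-! ### The sequential game -/

/-- `p(d) = 𝔼_{x ∼ p} [d(x)] = Pr_{x ∼ p} [d(x) = 1]`. -/
noncomputable def distProb {X : Type*} [MeasurableSpace X]
    (p : ProbabilityMeasure X) (d : X → Bool) : ℝ :=
  (p : Measure X).real {x | d x = true}

/-- The integral probability metric `IPM_D(p, q) = sup_{d ∈ D} |p(d) - q(d)|`. -/
noncomputable def ipm {X : Type*} [MeasurableSpace X] (D : Set (X → Bool))
    (p q : ProbabilityMeasure X) : ℝ :=
  ⨆ d : D, |distProb p d.1 - distProb q d.1|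

/-- `D ∪ (1 - D)`. -/
def symmetrize {X : Type*} (D : Set (X → Bool)) : Set (X → Bool) :=
  D ∪ (fun d x => !(d x)) '' D

/-- A (deterministic) generator: it submits a distribution, given the list of distinguishers
received so far, in chronological order. -/
abbrev Generator (X : Type*) [MeasurableSpace X] : Type _ :=
  List (X → Bool) → ProbabilityMeasure X

/-- A (deterministic) discriminator for the class `D` with error parameter `ε`.
`reply preal h p` is its reply when the target distribution is `preal`, the previous rounds were
`h` (the submitted distributions and the replies, in chronological order) and the generator now
submits `p`. The reply `none` means "WIN". -/
structure Discriminator {X : Type*} [MeasurableSpace X] (D : Set (X → Bool)) (ε : ℝ) where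
  reply : ProbabilityMeasure X → List (ProbabilityMeasure X × (X → Bool)) →
    ProbabilityMeasure X → Option (X → Bool)
  reply_win : ∀ preal h p, ipm D p preal ≤ ε → reply preal h p = none
  reply_distinguish : ∀ preal h p, ε < ipm D p preal →
    ∃ d ∈ symmetrize D, reply preal h p = some d ∧ ε < distProb preal d - distProb p d

/-- `GeneratorWins G A preal T h`: when `G` plays against `A` with target distribution `preal`,
starting after the rounds `h`, the game terminates with "WIN" after at most `T` more rounds. -/
def GeneratorWins {X : Type*} [MeasurableSpace X] {D : Set (X → Bool)} {ε : ℝ}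
    (G : Generator X) (A : Discriminator D ε) (preal : ProbabilityMeasure X) :
    ℕ → List (ProbabilityMeasure X × (X → Bool)) → Prop
  | 0, _ => False
  | T + 1, h =>
      match A.reply preal h (G (h.map Prod.snd)) with
      | none => True
      | some d => GeneratorWins G A preal T (h ++ [(G (h.map Prod.snd), d)])

/-- Some generator wins against every discriminator with every target distribution after at most
`T` rounds, with error parameter `ε`. -/
def SequentialFoolableWithin {X : Type*} [MeasurableSpace X] (D : Set (X → Bool))
    (ε : ℝ) (T : ℕ) : Prop :=
  ∃ G : Generator X, ∀ (A : Discriminator D ε) (preal : ProbabilityMeasure X),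
    GeneratorWins G A preal T []

/-- `D` is `ε`-Sequential-Foolable. -/
def EpsSequentialFoolable {X : Type*} [MeasurableSpace X] (D : Set (X → Bool)) (ε : ℝ) : Prop :=
  ∃ T : ℕ, SequentialFoolableWithin D ε T

/-- `D` is Sequential-Foolable: it is `ε`-Sequential-Foolable for every `ε > 0`, with a number of
rounds `T(ε)` bounded by a polynomial in `1/ε`. -/
def SequentialFoolable {X : Type*} [MeasurableSpace X] (D : Set (X → Bool)) : Prop :=
  ∃ P : Polynomial ℝ, ∀ ε : ℝ, 0 < ε →
    ∃ T : ℕ, (T : ℝ) ≤ P.eval (1 / ε) ∧ SequentialFoolableWithin D ε T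

/-! ### Shattered trees and thresholds of a binary relation -/

/-! Duality (3 ↔ 4). The two dimensions concern one relation `d x` and its transpose. By a Ramsey
argument on trees, a relation shattering deep trees contains long half graphs
(`exists_thresholdList_of_treeShattered`), and binary search along a half graph shatters a tree for
the transpose (`IsThresholdList.treeShattered_swap`).

Lower bound (2 → 3). Given a dual shattered tree, the discriminator walks down it: at a node `d` it
replies whichever of `d`, `1 - d` has mass at most 1/2 under the submission, and moves to the child
where that reply is 1. A point realizing the path, taken as a Dirac target, makes every gap at least
1/2 > ε.

Upper bound (3 → 1). Finite dual dimension yields an online forecaster of the values `d x`, for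
unknown `x`, with regret at most ε/16 per round over N = O(ε⁻⁴) rounds; the potential is
exponential, with a Sauer–Shelah count. Its forecast `f : D → ℝ` need not come from a distribution.
But either `f` is within ε/2 of some `d ↦ p(d)`, or some signed mixture of the `d` separates every
`x` from `f` by ε/4 (`Predictable.exists_close_or_exists_separating`): otherwise finite minimax
builds a half graph of mixtures, on which binary search beats the forecaster. In the first case the
generator submits `p` and passes the reply to the forecaster; in the second it passes on the mixture
without playing a round. Either way the gain averaged over the target grows by at least ε/4, so N
unsuccessful rounds would contradict the regret bound. -/

/-- The class of the functions `fun a => R a b`, for `b ∈ C`, shatters a complete binary tree of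
depth `n` with labels in `S`. -/
def TreeShattered {A B : Type*} (R : A → B → Bool) (S : Set A) : ℕ → Set B → Prop
  | 0, C => C.Nonempty
  | n + 1, C => ∃ a ∈ S, TreeShattered R S n {b ∈ C | R a b = false} ∧
      TreeShattered R S n {b ∈ C | R a b = true}

theorem MistakeTree.shatteredBy_leaf {W : Type*} {H : Set (W → Bool)} :
    (MistakeTree.leaf : MistakeTree W 0).ShatteredBy H ↔ H.Nonempty := by
  simp [MistakeTree.ShatteredBy, MistakeTree.paths, Set.Nonempty]

theorem MistakeTree.shatteredBy_node {W : Type*} {n : ℕ} {w : W} {l r : MistakeTree W n}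
    {H : Set (W → Bool)} :
    (MistakeTree.node w l r).ShatteredBy H ↔
      l.ShatteredBy {h ∈ H | h w = false} ∧ r.ShatteredBy {h ∈ H | h w = true} := by
  simp only [MistakeTree.ShatteredBy, MistakeTree.paths, Set.mem_union, Set.mem_image]
  constructor
  · intro h
    constructor
    · intro s hs
      obtain ⟨g, hg, hgs⟩ := h _ (Or.inl ⟨s, hs, rfl⟩)
      simp only [List.mem_cons, forall_eq_or_imp] at hgs
      exact ⟨g, ⟨hg, hgs.1⟩, hgs.2⟩
    · intro s hs
      obtain ⟨g, hg, hgs⟩ := h _ (Or.inr ⟨s, hs, rfl⟩)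
      simp only [List.mem_cons, forall_eq_or_imp] at hgs
      exact ⟨g, ⟨hg, hgs.1⟩, hgs.2⟩
  · rintro ⟨h0, h1⟩ s (⟨s, hs, rfl⟩ | ⟨s, hs, rfl⟩)
    · obtain ⟨g, ⟨hg, hgw⟩, hgs⟩ := h0 s hs
      exact ⟨g, hg, by simpa only [List.mem_cons, forall_eq_or_imp] using ⟨hgw, hgs⟩⟩
    · obtain ⟨g, ⟨hg, hgw⟩, hgs⟩ := h1 s hs
      exact ⟨g, hg, by simpa only [List.mem_cons, forall_eq_or_imp] using ⟨hgw, hgs⟩⟩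

/-- Restating shattering for a relation lets a class and its dual differ only by transposing `R`. -/
theorem exists_mistakeTree_shatteredBy_iff {A B : Type*} (R : A → B → Bool) (n : ℕ) (C : Set B) :
    (∃ t : MistakeTree A n, t.ShatteredBy ((fun b a => R a b) '' C)) ↔
      TreeShattered R Set.univ n C := by
  induction n generalizing C with
  | zero =>
    constructor
    · rintro ⟨t, ht⟩
      cases t
      simpa [MistakeTree.shatteredBy_leaf, TreeShattered] using ht
    · intro h
      exact ⟨.leaf, MistakeTree.shatteredBy_leaf.2 (Set.Nonempty.image _ h)⟩
  | succ n ih =>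
    have key : ∀ (a : A) (y : Bool), {h ∈ (fun b a => R a b) '' C | h a = y} =
        (fun b a => R a b) '' {b ∈ C | R a b = y} := by
      intro a y
      ext g
      constructor
      · rintro ⟨⟨b, hb, rfl⟩, h⟩
        exact ⟨b, ⟨hb, h⟩, rfl⟩
      · rintro ⟨b, ⟨hb, h⟩, rfl⟩
        exact ⟨⟨b, hb, rfl⟩, h⟩
    constructor
    · rintro ⟨t, ht⟩
      cases t with
      | node a l r =>
        rw [MistakeTree.shatteredBy_node, key, key] at ht
        exact ⟨a, trivial, (ih _).1 ⟨l, ht.1⟩, (ih _).1 ⟨r, ht.2⟩⟩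
    · rintro ⟨a, -, h0, h1⟩
      obtain ⟨l, hl⟩ := (ih _).2 h0
      obtain ⟨r, hr⟩ := (ih _).2 h1
      refine ⟨.node a l r, ?_⟩
      rw [MistakeTree.shatteredBy_node, key, key]
      exact ⟨hl, hr⟩

section

variable {A B : Type*} {R : A → B → Bool}

theorem TreeShattered.mono {S S' : Set A} (hS : S ⊆ S') {n : ℕ} {C C' : Set B} (hC : C ⊆ C')
    (h : TreeShattered R S n C) : TreeShattered R S' n C' := by
  induction n generalizing C C' with
  | zero => exact Set.Nonempty.mono hC h
  | succ n ih =>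
    obtain ⟨a, ha, h0, h1⟩ := h
    exact ⟨a, hS ha, ih (fun b hb => ⟨hC hb.1, hb.2⟩) h0, ih (fun b hb => ⟨hC hb.1, hb.2⟩) h1⟩

theorem TreeShattered.nonempty {S : Set A} {n : ℕ} {C : Set B} (h : TreeShattered R S n C) :
    C.Nonempty := by
  induction n generalizing C with
  | zero => exact h
  | succ n ih =>
    obtain ⟨a, -, h0, -⟩ := h
    exact (ih h0).mono fun b hb => hb.1

theorem TreeShattered.of_le {S : Set A} {m n : ℕ} (hmn : m ≤ n) {C : Set B}
    (h : TreeShattered R S n C) : TreeShattered R S m C := by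
  induction m generalizing n C with
  | zero => exact h.nonempty
  | succ m ih =>
    obtain ⟨n, rfl⟩ : ∃ k, n = k + 1 := ⟨n - 1, by omega⟩
    obtain ⟨a, ha, h0, h1⟩ := h
    exact ⟨a, ha, ih (by omega) h0, ih (by omega) h1⟩

theorem littlestoneDim_image_lt_top_iff (C : Set B) :
    littlestoneDim ((fun b a => R a b) '' C) < ⊤ ↔ ∃ n, ¬ TreeShattered R Set.univ n C := by
  simp only [littlestoneDim, exists_mistakeTree_shatteredBy_iff]
  constructor
  · intro h
    by_contra! hall
    simp only [hall, iSup_pos, ENat.iSup_natCast, lt_self_iff_false] at h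
  · rintro ⟨n, hn⟩
    refine lt_of_le_of_lt (iSup₂_le fun m hm => ?_) (ENat.natCast_lt_top n)
    by_contra! hlt
    exact hn (hm.of_le (by exact_mod_cast hlt.le))

/-- The Ramsey property of complete binary trees. -/
theorem TreeShattered.ramsey {S : Set A} (P : Set A) {m n : ℕ} {C : Set B}
    (h : TreeShattered R S (m + n) C) :
    TreeShattered R (S ∩ P) m C ∨ TreeShattered R (S ∩ Pᶜ) n C := by
  induction hk : m + n generalizing m n C with
  | zero =>
    obtain rfl : m = 0 := by omega
    exact Or.inl h.nonempty
  | succ k ih =>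
    rcases Nat.eq_zero_or_pos m with rfl | hm
    · exact Or.inl h.nonempty
    rcases Nat.eq_zero_or_pos n with rfl | hn
    · exact Or.inr h.nonempty
    have hsub : ∀ (a : A) (y : Bool), {b ∈ C | R a b = y} ⊆ C := fun a y b hb => hb.1
    rw [hk] at h
    obtain ⟨a, ha, h0, h1⟩ := h
    -- The root can extend only trees of its own colour. If both subtrees yield one, the root joins
    -- them; otherwise a subtree already contains a tree of the other colour in full depth.
    by_cases haP : a ∈ P
    · obtain ⟨m, rfl⟩ : ∃ j, m = j + 1 := ⟨m - 1, by omega⟩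
      obtain rfl : k = m + n := by omega
      rcases ih h0 rfl with h0 | h0
      · rcases ih h1 rfl with h1 | h1
        · exact Or.inl ⟨a, ⟨ha, haP⟩, h0, h1⟩
        · exact Or.inr (h1.mono subset_rfl (hsub _ _))
      · exact Or.inr (h0.mono subset_rfl (hsub _ _))
    · obtain ⟨n, rfl⟩ : ∃ j, n = j + 1 := ⟨n - 1, by omega⟩
      obtain rfl : k = m + n := by omega
      rcases ih h0 rfl with h0 | h0
      · exact Or.inl (h0.mono subset_rfl (hsub _ _))
      · rcases ih h1 rfl with h1 | h1
        · exact Or.inl (h1.mono subset_rfl (hsub _ _))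
        · exact Or.inr ⟨a, ⟨ha, haP⟩, h0, h1⟩

variable (R) in
/-- A list of pairs `(aᵢ, bᵢ)` in `S × C` such that `R aⱼ bᵢ = y` if and only if `i ≤ j`. -/
structure IsThresholdList (y : Bool) (S : Set A) (C : Set B) (l : List (A × B)) : Prop where
  mem : ∀ e ∈ l, e.1 ∈ S ∧ e.2 ∈ C
  diag : ∀ e ∈ l, R e.1 e.2 = y
  pairwise : l.Pairwise fun e e' => R e'.1 e.2 = y ∧ R e.1 e'.2 = !y

theorem IsThresholdList.mono {y : Bool} {S S' : Set A} {C C' : Set B} {l : List (A × B)}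
    (hS : S ⊆ S') (hC : C ⊆ C') (h : IsThresholdList R y S C l) : IsThresholdList R y S' C' l :=
  ⟨fun e he => ⟨hS (h.mem e he).1, hC (h.mem e he).2⟩, h.diag, h.pairwise⟩

theorem IsThresholdList.cons {y : Bool} {S : Set A} {C : Set B} {l : List (A × B)} {a : A} {b : B}
    (ha : a ∈ S) (hb : b ∈ C) (hab : R a b = y)
    (h : IsThresholdList R y (S ∩ {a | R a b = y}) {b ∈ C | R a b = !y} l) :
    IsThresholdList R y S C ((a, b) :: l) := by
  refine ⟨?_, ?_, ?_⟩
  · rintro e (_ | ⟨_, he⟩)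
    · exact ⟨ha, hb⟩
    · exact ⟨(h.mem e he).1.1, (h.mem e he).2.1⟩
  · rintro e (_ | ⟨_, he⟩)
    · exact hab
    · exact h.diag e he
  · exact List.pairwise_cons.2 ⟨fun e he => ⟨(h.mem e he).1.2, (h.mem e he).2.2⟩, h.pairwise⟩

/-- A relation that shatters deep trees has long thresholds. -/
theorem exists_thresholdList_of_treeShattered (m n : ℕ) :
    ∃ k, ∀ (S : Set A) (C : Set B), TreeShattered R S k C →
      (∃ l, IsThresholdList R true S C l ∧ l.length = m) ∨
        ∃ l, IsThresholdList R false S C l ∧ l.length = n := by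
  induction hk : m + n generalizing m n with
  | zero =>
    obtain rfl : m = 0 := by omega
    exact ⟨0, fun S C _ => Or.inl ⟨[], ⟨by simp, by simp, by simp⟩, rfl⟩⟩
  | succ k ih =>
    rcases Nat.eq_zero_or_pos m with rfl | hm
    · exact ⟨0, fun S C _ => Or.inl ⟨[], ⟨by simp, by simp, by simp⟩, rfl⟩⟩
    rcases Nat.eq_zero_or_pos n with rfl | hn
    · exact ⟨0, fun S C _ => Or.inr ⟨[], ⟨by simp, by simp, by simp⟩, rfl⟩⟩
    obtain ⟨m, rfl⟩ : ∃ j, m = j + 1 := ⟨m - 1, by omega⟩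
    obtain ⟨n, rfl⟩ : ∃ j, n = j + 1 := ⟨n - 1, by omega⟩
    obtain ⟨k₁, hk₁⟩ := ih m (n + 1) (by omega)
    obtain ⟨k₀, hk₀⟩ := ih (m + 1) n (by omega)
    refine ⟨(k₁ + 1) + (k₀ + 1), fun S C h => ?_⟩
    -- Fix any `b` and colour the labels `a` by `R a b`. The root `a` of a monochromatic tree gives
    -- the first pair; continuing in the child where `R a` takes the value opposite to `R a b` gives
    -- the later ones.
    obtain ⟨b, hb⟩ := h.nonempty
    rcases h.ramsey {a | R a b = true} with h | h
    · obtain ⟨a, ⟨haS, hab⟩, h, -⟩ := h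
      rcases hk₁ _ _ h with ⟨l, hl, rfl⟩ | ⟨l, hl, hlen⟩
      · exact Or.inl ⟨(a, b) :: l, IsThresholdList.cons haS hb hab hl, rfl⟩
      · exact Or.inr ⟨l, hl.mono Set.inter_subset_left fun b hb => hb.1, hlen⟩
    · have hc : {a | R a b = true}ᶜ = {a | R a b = false} := by
        ext a
        simp
      rw [hc] at h
      obtain ⟨a, ⟨haS, hab⟩, -, h⟩ := h
      rcases hk₀ _ _ h with ⟨l, hl, hlen⟩ | ⟨l, hl, rfl⟩
      · exact Or.inl ⟨l, hl.mono Set.inter_subset_left fun b hb => hb.1, hlen⟩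
      · exact Or.inr ⟨(a, b) :: l, IsThresholdList.cons haS hb hab hl, rfl⟩

/-- Binary search: thresholds of length `2 ^ n` yield a shattered tree of depth `n` for the
transposed relation. -/
theorem IsThresholdList.treeShattered_swap {y : Bool} {S : Set A} {C : Set B} {n : ℕ}
    {l : List (A × B)} (hl : IsThresholdList R y S C l) (hlen : l.length = 2 ^ n) :
    TreeShattered (fun b a => R a b) C n S := by
  induction n generalizing l S with
  | zero =>
    match l, hlen with
    | e :: _, _ => exact ⟨e.1, (hl.mem e (by simp)).1⟩
  | succ n ih =>
    have hpow : 2 ^ (n + 1) = 2 ^ n + 2 ^ n := by ring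
    have hpos : 0 < 2 ^ n := by positivity
    obtain ⟨l₁, e, l₂, rfl, h₁, h₂⟩ : ∃ l₁ e l₂, l = l₁ ++ e :: l₂ ∧ l₁.length = 2 ^ n ∧
        (e :: l₂).length = 2 ^ n := by
      have hd : (l.drop (2 ^ n)).length = 2 ^ n := by
        rw [List.length_drop]
        omega
      match hq : l.drop (2 ^ n), hd with
      | [], hd => exact absurd hd hpos.ne
      | e :: l₂, hd =>
        refine ⟨l.take (2 ^ n), e, l₂, ?_, ?_, hd⟩
        · rw [← hq, List.take_append_drop]
        · rw [List.length_take]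
          omega
    obtain ⟨hp₁, hp₂, hp⟩ := List.pairwise_append.1 hl.pairwise
    have hT₁ : IsThresholdList R y {a ∈ S | R a e.2 = !y} C l₁ :=
      ⟨fun x hx => ⟨⟨(hl.mem x (by simp [hx])).1, (hp x hx e (by simp)).2⟩,
        (hl.mem x (by simp [hx])).2⟩, fun x hx => hl.diag x (by simp [hx]), hp₁⟩
    have hT₂ : IsThresholdList R y {a ∈ S | R a e.2 = y} C (e :: l₂) := by
      refine ⟨fun x hx => ⟨⟨(hl.mem x (List.mem_append_right _ hx)).1, ?_⟩,
        (hl.mem x (List.mem_append_right _ hx)).2⟩,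
        fun x hx => hl.diag x (List.mem_append_right _ hx), hp₂⟩
      rcases List.mem_cons.1 hx with rfl | hx
      · exact hl.diag x (by simp)
      · exact ((List.pairwise_cons.1 hp₂).1 x hx).1
    have g₁ := ih hT₁ h₁
    have g₂ := ih hT₂ h₂
    -- The column of the middle pair separates the two halves; `y` only decides which half is the
    -- left child.
    refine ⟨e.2, (hl.mem e (by simp)).2, ?_⟩
    cases y
    · exact ⟨g₂, g₁⟩
    · exact ⟨g₁, g₂⟩

theorem forall_treeShattered_swap (h : ∀ n, TreeShattered R Set.univ n Set.univ) (n : ℕ) :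
    TreeShattered (fun b a => R a b) Set.univ n Set.univ := by
  obtain ⟨k, hk⟩ := exists_thresholdList_of_treeShattered (R := R) (2 ^ n) (2 ^ n)
  rcases hk _ _ (h k) with ⟨l, hl, hlen⟩ | ⟨l, hl, hlen⟩ <;> exact hl.treeShattered_swap hlen

end

/-! ### Equivalence of finite Littlestone and dual Littlestone dimension. -/

theorem littlestoneDim_lt_top_iff {X : Type*} (D : Set (X → Bool)) :
    littlestoneDim D < ⊤ ↔
      ∃ n, ¬ TreeShattered (fun (x : X) (d : D) => d.1 x) Set.univ n Set.univ := by
  rw [← littlestoneDim_image_lt_top_iff]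
  simp

theorem dualLittlestoneDim_lt_top_iff {X : Type*} (D : Set (X → Bool)) :
    dualLittlestoneDim D < ⊤ ↔
      ∃ n, ¬ TreeShattered (fun (d : D) (x : X) => d.1 x) Set.univ n Set.univ := by
  rw [← littlestoneDim_image_lt_top_iff, dualLittlestoneDim, dualClass, Set.image_univ]

theorem dualLittlestoneDim_lt_top_iff_littlestoneDim_lt_top {X : Type*} (D : Set (X → Bool)) :
    dualLittlestoneDim D < ⊤ ↔ littlestoneDim D < ⊤ := by
  rw [littlestoneDim_lt_top_iff, dualLittlestoneDim_lt_top_iff, ← not_iff_not]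
  simp only [not_exists, not_not]
  exact ⟨fun h n => forall_treeShattered_swap h n, fun h n => forall_treeShattered_swap h n⟩

/-! ### Online prediction -/

/-- Finite minimax alternative: Hahn–Banach separates `V` from the open orthant below `a`. A
functional bounded above on that orthant has nonnegative coefficients, which are normalized to
weights. -/
theorem exists_forall_lt_or_exists_stdSimplex {ι : Type*} [Fintype ι] [Nonempty ι]
    {V : Set (ι → ℝ)} (hV : Convex ℝ V) (a : ℝ) :
    (∃ v ∈ V, ∀ i, v i < a) ∨ ∃ w ∈ stdSimplex ℝ ι, ∀ v ∈ V, a ≤ ∑ i, w i * v i := by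
  classical
  rcases V.eq_empty_or_nonempty with rfl | ⟨v₀, hv₀⟩
  · exact Or.inr ⟨_, single_mem_stdSimplex ℝ (Classical.arbitrary ι), by simp⟩
  by_cases hdis : ∃ v ∈ V, ∀ i, v i < a
  · exact Or.inl hdis
  right
  push Not at hdis
  let U : Set (ι → ℝ) := Set.univ.pi fun _ => Set.Iio a
  have hUo : IsOpen U := isOpen_set_pi Set.finite_univ fun _ _ => isOpen_Iio
  have hUc : Convex ℝ U := convex_pi fun _ _ => convex_Iio a
  have hUV : Disjoint U V := by
    rw [Set.disjoint_left]
    intro v hvU hvV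
    obtain ⟨i, hi⟩ := hdis v hvV
    exact absurd (hvU i trivial) (not_lt.2 hi)
  obtain ⟨φ, u, hφU, hφV⟩ := geometric_hahn_banach_open hUc hUo hV hUV
  let g : ι → ℝ := fun i => φ (Pi.single i 1)
  have hφ : ∀ v, φ v = ∑ i, g i * v i := by
    intro v
    conv_lhs => rw [pi_eq_sum_univ' v, map_sum]
    refine Finset.sum_congr rfl fun i _ => ?_
    rw [map_smul, smul_eq_mul, mul_comm]
  have hg : ∀ i, 0 ≤ g i := by
    intro i
    by_contra! hi
    -- A step this long in direction `-i` stays in the orthant but pushes `φ` beyond the bound `u`.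
    let t : ℝ := (|u| + |∑ j, g j * (a - 1)|) / (-g i)
    have ht : 0 ≤ t := div_nonneg (by positivity) (by linarith)
    have hmem : (fun j => (a - 1) - if j = i then t else 0) ∈ U := by
      intro j _
      simp only [Set.mem_Iio]
      split_ifs <;> linarith
    have h := hφU _ hmem
    rw [hφ] at h
    simp only [mul_sub, Finset.sum_sub_distrib, mul_ite, mul_zero, Finset.sum_ite_eq',
      Finset.mem_univ, if_true] at h
    have h2 : g i * t = -(|u| + |∑ j, g j * (a - 1)|) := by
      rw [← neg_inj, neg_neg, ← neg_mul, mul_div_cancel₀ _ (by linarith)]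
    rw [h2] at h
    simp only [mul_sub, Finset.sum_sub_distrib] at h
    have h3 := neg_abs_le (∑ j, g j * a - ∑ j, g j * 1)
    have h4 := le_abs_self u
    linarith
  have hlt : ∀ b < a, b * ∑ i, g i < u := by
    intro b hb
    have h := hφU (fun _ => b) fun i _ => hb
    rwa [hφ, ← Finset.sum_mul, mul_comm] at h
  have hs : 0 < ∑ i, g i := by
    refine lt_of_le_of_ne (Finset.sum_nonneg fun i _ => hg i) fun h0 => ?_
    have hz := (Finset.sum_eq_zero_iff_of_nonneg fun i _ => hg i).1 h0.symm
    have h1 := hlt (a - 1) (by linarith)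
    have h2 := hφV v₀ hv₀
    rw [hφ, Finset.sum_eq_zero fun i hi => by rw [hz i hi, zero_mul]] at h2
    rw [← h0] at h1
    linarith
  have hau : a * ∑ i, g i ≤ u := by
    rw [← le_div_iff₀ hs]
    exact le_of_forall_lt fun b hb => (lt_div_iff₀ hs).2 (hlt b hb)
  refine ⟨fun i => g i / ∑ j, g j, ⟨fun i => div_nonneg (hg i) hs.le, ?_⟩, fun v hv => ?_⟩
  · rw [← Finset.sum_div, div_self hs.ne']
  · have h := hφV v hv
    rw [hφ] at h
    have h2 : ∑ i, g i / (∑ j, g j) * v i = (∑ i, g i * v i) / ∑ j, g j := by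
      rw [Finset.sum_div]
      exact Finset.sum_congr rfl fun i _ => by ring
    rw [h2, le_div_iff₀ hs]
    linarith

section

variable {A B : Type*}

/-- A forecaster that predicts `e b a` by `f a`, at points `a` chosen by an adversary, can keep the
gain of every `b ∈ B` after `k` more rounds nonpositive, when the gains are `c` now. In every
round the gain of `b` is `e b a - f a` or `f a - e b a`, at the choice of the adversary. -/
def Predictable (e : B → A → ℝ) : ℕ → (B → ℝ) → Prop
  | 0, c => ∀ b, c b ≤ 0
  | k + 1, c => ∃ f : A → ℝ, ∀ a,
      Predictable e k (fun b => c b + (e b a - f a)) ∧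
        Predictable e k (fun b => c b - (e b a - f a))

/-- The finite mixtures of the evaluations `f ↦ f a` and `f ↦ - f a`. -/
def signedMixtures (A : Type*) : Set ((A → ℝ) →ₗ[ℝ] ℝ) :=
  convexHull ℝ {q | ∃ a, q = LinearMap.proj a ∨ q = -LinearMap.proj a}

variable {e : B → A → ℝ}

theorem Predictable.mono {k : ℕ} {c c' : B → ℝ} (hc : ∀ b, c' b ≤ c b) (h : Predictable e k c) :
    Predictable e k c' := by
  induction k generalizing c c' with
  | zero => exact fun b => (hc b).trans (h b)
  | succ k ih =>
    obtain ⟨f, hf⟩ := h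
    exact ⟨f, fun a => ⟨ih (fun b => by linarith [hc b]) (hf a).1,
      ih (fun b => by linarith [hc b]) (hf a).2⟩⟩

/-- Forecasts can be averaged, because the updated gains are affine in the pair of current gains and
forecast. -/
theorem convex_setOf_predictable (e : B → A → ℝ) (k : ℕ) :
    Convex ℝ {c | Predictable e k c} := by
  induction k with
  | zero =>
    intro c hc c' hc' s t hs ht _ b
    have h1 := mul_nonpos_of_nonneg_of_nonpos hs (hc b)
    have h2 := mul_nonpos_of_nonneg_of_nonpos ht (hc' b)
    simp only [Pi.add_apply, Pi.smul_apply, smul_eq_mul]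
    linarith
  | succ k ih =>
    rintro c ⟨f, hf⟩ c' ⟨f', hf'⟩ s t hs ht hst
    refine ⟨s • f + t • f', fun a => ⟨?_, ?_⟩⟩
    · refine Predictable.mono (fun b => le_of_eq ?_) (ih (hf a).1 (hf' a).1 hs ht hst)
      simp only [Pi.add_apply, Pi.smul_apply, smul_eq_mul]
      linear_combination (-(e b a)) * hst
    · refine Predictable.mono (fun b => le_of_eq ?_) (ih (hf a).2 (hf' a).2 hs ht hst)
      simp only [Pi.add_apply, Pi.smul_apply, smul_eq_mul]
      linear_combination (e b a) * hst

/-- The forecast `f` is fixed before the point is chosen, so by convexity its guarantee for single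
points extends to mixtures: the adversary may play these too. -/
theorem Predictable.exists_forall_signedMixtures {k : ℕ} {c : B → ℝ}
    (h : Predictable e (k + 1) c) :
    ∃ f : A → ℝ, ∀ q ∈ signedMixtures A, Predictable e k (fun b => c b + (q (e b) - q f)) ∧
      Predictable e k (fun b => c b - (q (e b) - q f)) := by
  obtain ⟨f, hf⟩ := h
  refine ⟨f, fun q hq => ?_⟩
  refine convexHull_min (t := {q : (A → ℝ) →ₗ[ℝ] ℝ |
    Predictable e k (fun b => c b + (q (e b) - q f)) ∧
      Predictable e k (fun b => c b - (q (e b) - q f))}) ?_ ?_ hq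
  · rintro q ⟨a, rfl | rfl⟩
    · exact hf a
    · refine ⟨(hf a).2.mono fun b => ?_, (hf a).1.mono fun b => ?_⟩ <;>
        simp only [LinearMap.neg_apply, LinearMap.proj_apply] <;> linarith
  · rintro q hq q' hq' s t hs ht hst
    constructor
    · refine Predictable.mono (fun b => le_of_eq ?_) (convex_setOf_predictable e k hq.1 hq'.1 hs ht hst)
      simp only [Pi.add_apply, Pi.smul_apply, smul_eq_mul, LinearMap.add_apply,
        LinearMap.smul_apply]
      linear_combination (-(c b)) * hst
    · refine Predictable.mono (fun b => le_of_eq ?_) (convex_setOf_predictable e k hq.2 hq'.2 hs ht hst)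
      simp only [Pi.add_apply, Pi.smul_apply, smul_eq_mul, LinearMap.add_apply,
        LinearMap.smul_apply]
      linear_combination (-(c b)) * hst

/-- Mixtures `pₜ` of the rows of `e` and `qₛ` of its columns which form a half graph with gap `2γ`
enable the adversary to increase the gain of some `pₜ` by `γ` in every round. -/
theorem Predictable.exists_apply_add_le_of_halfGraph {f : A → ℝ} {p : ℕ → A → ℝ}
    {q : ℕ → (A → ℝ) →ₗ[ℝ] ℝ} {α γ : ℝ} (hp : ∀ t, p t ∈ convexHull ℝ (Set.range e))
    (hq : ∀ s, q s ∈ signedMixtures A) (hlt : ∀ s t, s < t → q s (p t) - q s f ≤ α - γ)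
    (hle : ∀ s t, t ≤ s → α + γ ≤ q s (p t) - q s f) (k i : ℕ) (C : (A → ℝ) →ₗ[ℝ] ℝ) (r : ℝ)
    (h : Predictable e k (fun b => C (e b) + r)) :
    ∃ t, i ≤ t ∧ t < i + 2 ^ k ∧ C (p t) + r + k * γ ≤ 0 := by
  induction k generalizing i C r with
  | zero =>
    refine ⟨i, le_rfl, by simp, ?_⟩
    -- The guarantee concerns rows only; being a linear inequality, it passes to their mixtures.
    have : p i ∈ {x | C x ≤ -r} := by
      refine convexHull_min ?_ (convex_halfSpace_le C.isLinear (-r)) (hp i)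
      rintro _ ⟨b, rfl⟩
      have := h b
      simp only [Set.mem_ofPred_eq]
      linarith
    simp only [Set.mem_ofPred_eq] at this
    simp only [Nat.cast_zero, zero_mul, add_zero]
    linarith
  | succ k ih =>
    have hpow : 2 ^ (k + 1) = 2 ^ k + 2 ^ k := by ring
    have hpos : 0 < 2 ^ k := by positivity
    obtain ⟨g, hg⟩ := h.exists_forall_signedMixtures
    -- Binary search: this index ends the first half of the range. The values of its mixture on the
    -- two halves lie at least γ to either side of `α + q f`, so whichever side the forecast takes,
    -- one half gains γ.
    obtain ⟨h1, h2⟩ := hg _ (hq (i + 2 ^ k - 1))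
    rcases le_total (q (i + 2 ^ k - 1) g - q (i + 2 ^ k - 1) f) α with hc | hc
    · obtain ⟨t, ht, ht', h⟩ := ih i (C + q (i + 2 ^ k - 1)) (r - q (i + 2 ^ k - 1) g)
        (h1.mono fun b => by simp only [LinearMap.add_apply]; linarith)
      refine ⟨t, ht, by omega, ?_⟩
      have := hle (i + 2 ^ k - 1) t (by omega)
      simp only [LinearMap.add_apply] at h
      push_cast
      linarith
    · obtain ⟨t, ht, ht', h⟩ := ih (i + 2 ^ k) (C - q (i + 2 ^ k - 1)) (r + q (i + 2 ^ k - 1) g)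
        (h2.mono fun b => by simp only [LinearMap.sub_apply]; linarith)
      refine ⟨t, by omega, by omega, ?_⟩
      have := hlt (i + 2 ^ k - 1) t (by omega)
      simp only [LinearMap.sub_apply] at h
      push_cast
      linarith

/-- A minimax theorem: a function `f` is uniformly close to a mixture of the rows of `e`, or
separated from all of them by a mixture of evaluations. -/
theorem Predictable.exists_close_or_exists_separating [Nonempty A] [Nonempty B] {m : ℕ} {δ : ℝ}
    (hm : 0 < m) (h : Predictable e m (fun _ => -(δ * m))) {α γ : ℝ} (hδ : δ < γ) (f : A → ℝ) :
    (∃ p ∈ convexHull ℝ (Set.range e), ∀ a, |p a - f a| ≤ α + γ) ∨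
      ∃ q ∈ signedMixtures A, ∀ b, α - γ ≤ q (e b) - q f := by
  classical
  by_contra! hcon
  obtain ⟨hfar, hsep⟩ := hcon
  -- By minimax, failure for a finite set of `q` would give one mixture of them separating all rows;
  -- `hfar'` is the dual statement, with a mixture of the `p` close to `f`.
  have hsep' : ∀ s : Finset ((A → ℝ) →ₗ[ℝ] ℝ), (∀ q ∈ s, q ∈ signedMixtures A) →
      ∃ p ∈ convexHull ℝ (Set.range e), ∀ q ∈ s, q p - q f < α - γ := by
    intro s hs
    rcases s.eq_empty_or_nonempty with rfl | hne
    · exact ⟨e (Classical.arbitrary B), subset_convexHull ℝ _ ⟨_, rfl⟩, by simp⟩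
    have : Nonempty s := hne.to_subtype
    let L : (A → ℝ) →ₗ[ℝ] (s → ℝ) := LinearMap.pi fun q => q.1
    have hV : Convex ℝ ((fun v => v - L f) '' (L '' convexHull ℝ (Set.range e))) := by
      have := ((convex_convexHull ℝ (Set.range e)).linear_image L).translate (-L f)
      simpa only [sub_eq_neg_add] using this
    rcases exists_forall_lt_or_exists_stdSimplex hV (α - γ) with ⟨_, ⟨_, ⟨p, hp, rfl⟩, rfl⟩, hv⟩ |
      ⟨w, hw, hwv⟩
    · exact ⟨p, hp, fun q hq => hv ⟨q, hq⟩⟩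
    · exfalso
      obtain ⟨b, hb⟩ := hsep (∑ q : s, w q • q.1)
        ((convex_convexHull ℝ _).sum_mem (fun q _ => hw.1 q) hw.2 fun q _ => hs q.1 q.2)
      have := hwv _ ⟨_, ⟨e b, subset_convexHull ℝ _ ⟨b, rfl⟩, rfl⟩, rfl⟩
      simp only [L, Pi.sub_apply, LinearMap.pi_apply, mul_sub, Finset.sum_sub_distrib] at this
      simp only [LinearMap.sum_apply, LinearMap.smul_apply, smul_eq_mul] at hb
      linarith
  have hfar' : ∀ s : Finset (A → ℝ), (∀ p ∈ s, p ∈ convexHull ℝ (Set.range e)) →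
      ∃ q ∈ signedMixtures A, ∀ p ∈ s, α + γ < q p - q f := by
    intro s hs
    rcases s.eq_empty_or_nonempty with rfl | hne
    · exact ⟨LinearMap.proj (Classical.arbitrary A),
        subset_convexHull ℝ _ ⟨_, Or.inl rfl⟩, by simp⟩
    have : Nonempty s := hne.to_subtype
    let L : ((A → ℝ) →ₗ[ℝ] ℝ) →ₗ[ℝ] (s → ℝ) :=
      LinearMap.pi fun p => LinearMap.applyₗ f - LinearMap.applyₗ p.1
    have hV : Convex ℝ (L '' signedMixtures A) := (convex_convexHull ℝ _).linear_image L
    rcases exists_forall_lt_or_exists_stdSimplex hV (-(α + γ)) with ⟨_, ⟨q, hq, rfl⟩, hv⟩ |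
      ⟨w, hw, hwv⟩
    · refine ⟨q, hq, fun p hp => ?_⟩
      have := hv ⟨p, hp⟩
      simp only [L, LinearMap.pi_apply, LinearMap.sub_apply, LinearMap.applyₗ_apply_apply] at this
      linarith
    · exfalso
      obtain ⟨a, ha⟩ := hfar (∑ p : s, w p • p.1)
        ((convex_convexHull ℝ _).sum_mem (fun p _ => hw.1 p) hw.2 fun p _ => hs p.1 p.2)
      have key : ∀ q ∈ signedMixtures A, q (∑ p : s, w p • p.1) - q f ≤ α + γ := by
        intro q hq
        have := hwv _ ⟨q, hq, rfl⟩
        simp only [L, LinearMap.pi_apply, LinearMap.sub_apply, LinearMap.applyₗ_apply_apply, mul_sub,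
          Finset.sum_sub_distrib, ← Finset.sum_mul, hw.2] at this
        simp only [map_sum, map_smul, smul_eq_mul]
        linarith
      have h1 := key (LinearMap.proj a) (subset_convexHull ℝ _ ⟨a, Or.inl rfl⟩)
      have h2 := key (-LinearMap.proj a) (subset_convexHull ℝ _ ⟨a, Or.inr rfl⟩)
      simp only [LinearMap.neg_apply, LinearMap.proj_apply] at h1 h2
      exact absurd (abs_le.2 ⟨by linarith, h1⟩) (not_le.2 ha)
  -- Greedy half graph: each new `p` is chosen against all earlier `q`, then the new `q` against all
  -- `p` so far, including the new one, which settles the diagonal.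
  obtain ⟨u, hu, hu'⟩ := exists_seq_of_forall_finset_exists
    (fun z : (A → ℝ) × ((A → ℝ) →ₗ[ℝ] ℝ) => z.1 ∈ convexHull ℝ (Set.range e) ∧
      z.2 ∈ signedMixtures A ∧ α + γ < z.2 z.1 - z.2 f)
    (fun z z' => z.2 z'.1 - z.2 f < α - γ ∧ α + γ < z'.2 z.1 - z'.2 f) (by
      intro s hs
      obtain ⟨p, hp, hp'⟩ := hsep' (s.image Prod.snd) (by
        simp only [Finset.mem_image]
        rintro q ⟨z, hz, rfl⟩
        exact (hs z hz).2.1)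
      obtain ⟨q, hq, hq'⟩ := hfar' (insert p (s.image Prod.fst)) (by
        simp only [Finset.mem_insert, Finset.mem_image]
        rintro p' (rfl | ⟨z, hz, rfl⟩)
        · exact hp
        · exact (hs z hz).1)
      exact ⟨(p, q), ⟨hp, hq, hq' p (Finset.mem_insert_self _ _)⟩, fun z hz =>
        ⟨hp' _ (Finset.mem_image_of_mem _ hz),
          hq' _ (Finset.mem_insert_of_mem (Finset.mem_image_of_mem _ hz))⟩⟩)
  obtain ⟨t, -, -, ht⟩ := Predictable.exists_apply_add_le_of_halfGraph (f := f)
    (p := fun n => (u n).1) (q := fun n => (u n).2) (α := α) (γ := γ) (fun n => (hu n).1)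
    (fun n => (hu n).2.1) (fun s t hst => (hu' s t hst).1.le)
    (fun s t hts => by
      rcases hts.lt_or_eq with hts | rfl
      · exact (hu' t s hts).2.le
      · exact (hu t).2.2.le) m 0 0 (-(δ * m)) (h.mono fun b => by simp)
  have hm' : (0 : ℝ) < m := by exact_mod_cast hm
  simp only [LinearMap.zero_apply, zero_add] at ht
  nlinarith

end

/-! ### Prediction of classes of finite Littlestone dimension -/

section

variable {A B : Type*}

/-- The rows of a binary relation. -/
def relEval (R : A → B → Bool) (b : B) (a : A) : ℝ := if R a b then 1 else 0

/-- An upper bound `v` for the expectation of `sup_{b ∈ C} exp (η * (c b ± R a₁ b ± ⋯ ± R aₖ b))`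
with random signs and points `aᵢ` depending on the previous signs. -/
def ExpBounded (R : A → B → Bool) (η : ℝ) : ℕ → Set B → (B → ℝ) → ℝ → Prop
  | 0, C, c, v => 0 < v ∧ ∀ b ∈ C, Real.exp (η * c b) ≤ v
  | k + 1, C, c, v => 0 < v ∧ ∀ a, ∃ v₁ v₂,
      ExpBounded R η k C (fun b => c b + relEval R b a) v₁ ∧
      ExpBounded R η k C (fun b => c b - relEval R b a) v₂ ∧ (v₁ + v₂) / 2 ≤ v

variable {R : A → B → Bool} {η : ℝ}

theorem ExpBounded.pos {k : ℕ} {C : Set B} {c : B → ℝ} {v : ℝ} (h : ExpBounded R η k C c v) :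
    0 < v := by
  cases k <;> exact h.1

theorem ExpBounded.add_const {k : ℕ} {C : Set B} {c : B → ℝ} {v : ℝ}
    (h : ExpBounded R η k C c v) (r : ℝ) :
    ExpBounded R η k C (fun b => c b + r) (Real.exp (η * r) * v) := by
  induction k generalizing c v with
  | zero =>
    refine ⟨mul_pos (Real.exp_pos _) h.1, fun b hb => ?_⟩
    rw [mul_add, add_comm, Real.exp_add]
    exact mul_le_mul_of_nonneg_left (h.2 b hb) (Real.exp_pos _).le
  | succ k ih =>
    refine ⟨mul_pos (Real.exp_pos _) h.1, fun a => ?_⟩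
    obtain ⟨v₁, v₂, h₁, h₂, hv⟩ := h.2 a
    refine ⟨Real.exp (η * r) * v₁, Real.exp (η * r) * v₂, ?_, ?_, ?_⟩
    · convert ih h₁ using 2
      ring
    · convert ih h₂ using 2
      ring
    · rw [← mul_add, mul_div_assoc]
      exact mul_le_mul_of_nonneg_left hv (Real.exp_pos _).le

theorem ExpBounded.union {k : ℕ} {C C' : Set B} {c : B → ℝ} {v v' : ℝ}
    (h : ExpBounded R η k C c v) (h' : ExpBounded R η k C' c v') :
    ExpBounded R η k (C ∪ C') c (v + v') := by
  induction k generalizing c v v' with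
  | zero =>
    refine ⟨add_pos h.1 h'.1, ?_⟩
    rintro b (hb | hb)
    · linarith [h.2 b hb, h'.1]
    · linarith [h'.2 b hb, h.1]
  | succ k ih =>
    refine ⟨add_pos h.1 h'.1, fun a => ?_⟩
    obtain ⟨v₁, v₂, h₁, h₂, hv⟩ := h.2 a
    obtain ⟨v₁', v₂', h₁', h₂', hv'⟩ := h'.2 a
    exact ⟨_, _, ih h₁ h₁', ih h₂ h₂', by linarith⟩

theorem expBounded_empty (k : ℕ) (c : B → ℝ) {v : ℝ} (hv : 0 < v) :
    ExpBounded R η k ∅ c v := by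
  induction k generalizing c with
  | zero => exact ⟨hv, by simp⟩
  | succ k ih => exact ⟨hv, fun a => ⟨v, v, ih _, ih _, by linarith⟩⟩

/-- Sauer–Shelah with weights: any point `a` splits `C` in two, and one part loses a level of
shattering. The part with value 0 keeps its gain; the part with value 1 moves by ±1, which costs a
factor `cosh η` on average. -/
theorem expBounded_of_not_treeShattered {k r : ℕ} {C : Set B} {c : B → ℝ} {z : ℝ}
    (hC : ¬ TreeShattered R Set.univ r C) (hc : ∀ b ∈ C, c b = z) :
    ExpBounded R η k C c (Real.exp (η * z) * (Real.cosh η ^ k * ((k : ℝ) + 1) ^ r)) := by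
  have hcosh := Real.one_le_cosh η
  induction k generalizing r C c z with
  | zero =>
    refine ⟨by positivity, fun b hb => ?_⟩
    simp [hc b hb]
  | succ k ih =>
    cases r with
    | zero =>
      obtain rfl := Set.not_nonempty_iff_eq_empty.1 hC
      exact expBounded_empty _ _ (by positivity)
    | succ r =>
      refine ⟨by positivity, fun a => ?_⟩
      have hsub : ∀ y, ¬ TreeShattered R Set.univ (r + 1) {b ∈ C | R a b = y} :=
        fun y h => hC (h.mono subset_rfl fun b hb => hb.1)
      have hor : ∃ r₀ r₁, ¬ TreeShattered R Set.univ r₀ {b ∈ C | R a b = false} ∧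
          ¬ TreeShattered R Set.univ r₁ {b ∈ C | R a b = true} ∧
          ((r₀ = r ∧ r₁ = r + 1) ∨ (r₀ = r + 1 ∧ r₁ = r)) := by
        by_cases h0 : TreeShattered R Set.univ r {b ∈ C | R a b = false}
        · exact ⟨r + 1, r, hsub _, fun h1 => hC ⟨a, trivial, h0, h1⟩, Or.inr ⟨rfl, rfl⟩⟩
        · exact ⟨r, r + 1, h0, hsub _, Or.inl ⟨rfl, rfl⟩⟩
      obtain ⟨r₀, r₁, h0, h1, hr⟩ := hor
      have hunion : C = {b ∈ C | R a b = false} ∪ {b ∈ C | R a b = true} := by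
        ext b
        cases hb : R a b <;> simp [hb]
      have hplus := (ih (c := fun b => c b + relEval R b a) (z := z) h0 fun b hb => by
        simp [relEval, hb.2, hc b hb.1]).union
          (ih (z := z + 1) h1 fun b hb => by simp [relEval, hb.2, hc b hb.1])
      have hminus := (ih (c := fun b => c b - relEval R b a) (z := z) h0 fun b hb => by
        simp [relEval, hb.2, hc b hb.1]).union
          (ih (z := z - 1) h1 fun b hb => by simp [relEval, hb.2, hc b hb.1])
      rw [← hunion] at hplus hminus
      refine ⟨_, _, hplus, hminus, ?_⟩
      · have hexp : Real.exp (η * (z + 1)) + Real.exp (η * (z - 1)) =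
            2 * (Real.exp (η * z) * Real.cosh η) := by
          rw [Real.cosh_eq, mul_add, mul_sub, mul_one, Real.exp_add, sub_eq_add_neg, Real.exp_add]
          ring
        have hle : ((k : ℝ) + 1) ^ r₀ + ((k : ℝ) + 1) ^ r₁ ≤ ((k : ℝ) + 1 + 1) ^ (r + 1) := by
          have hp : ((k : ℝ) + 1) ^ r ≤ ((k : ℝ) + 1 + 1) ^ r :=
            pow_le_pow_left₀ (by positivity) (by linarith) r
          have : ((k : ℝ) + 1) ^ r + ((k : ℝ) + 1) ^ (r + 1) ≤ ((k : ℝ) + 1 + 1) ^ (r + 1) := by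
            rw [pow_succ, pow_succ]
            nlinarith
          rcases hr with ⟨rfl, rfl⟩ | ⟨rfl, rfl⟩ <;> linarith
        have e1 : (0 : ℝ) < Real.exp (η * z) * Real.cosh η ^ k := by positivity
        push_cast
        calc _ = Real.exp (η * z) * Real.cosh η ^ k * ((k : ℝ) + 1) ^ r₀ +
              (Real.exp (η * (z + 1)) + Real.exp (η * (z - 1))) / 2 *
                (Real.cosh η ^ k * ((k : ℝ) + 1) ^ r₁) := by ring
          _ = Real.exp (η * z) * Real.cosh η ^ k * ((k : ℝ) + 1) ^ r₀ * 1 +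
              Real.exp (η * z) * Real.cosh η ^ k * ((k : ℝ) + 1) ^ r₁ * Real.cosh η := by
            rw [hexp]
            ring
          _ ≤ Real.exp (η * z) * Real.cosh η ^ k * ((k : ℝ) + 1) ^ r₀ * Real.cosh η +
              Real.exp (η * z) * Real.cosh η ^ k * ((k : ℝ) + 1) ^ r₁ * Real.cosh η := by
            gcongr
          _ = Real.exp (η * z) * Real.cosh η ^ k * Real.cosh η *
              (((k : ℝ) + 1) ^ r₀ + ((k : ℝ) + 1) ^ r₁) := by ring
          _ ≤ Real.exp (η * z) * Real.cosh η ^ k * Real.cosh η * ((k : ℝ) + 1 + 1) ^ (r + 1) := by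
            gcongr
          _ = _ := by ring

/-- The forecast `log v₁ / η` normalizes the bound after a plus sign to 1; after a minus sign it
becomes `v₁ * v₂`, at most 1 by AM–GM. -/
theorem ExpBounded.predictable (hη : 0 < η) {k : ℕ} {c : B → ℝ} {v : ℝ} (hv : v ≤ 1)
    (h : ExpBounded R η k Set.univ c v) : Predictable (relEval R) k c := by
  induction k generalizing c v with
  | zero =>
    intro b
    have := (h.2 b trivial).trans hv
    rw [Real.exp_le_one_iff] at this
    exact nonpos_of_mul_nonpos_right this hη
  | succ k ih =>
    choose v₁ v₂ h₁ h₂ hv₁₂ using h.2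
    refine ⟨fun a => Real.log (v₁ a) / η, fun a => ⟨?_, ?_⟩⟩
    · have h := (h₁ a).add_const (-(Real.log (v₁ a) / η))
      have hf : Real.exp (η * -(Real.log (v₁ a) / η)) * v₁ a = 1 := by
        rw [mul_neg, mul_div_cancel₀ _ hη.ne', Real.exp_neg, Real.exp_log (h₁ a).pos,
          inv_mul_cancel₀ (h₁ a).pos.ne']
      exact (ih hf.le h).mono fun b => by linarith
    · have h := (h₂ a).add_const (Real.log (v₁ a) / η)
      have hf : Real.exp (η * (Real.log (v₁ a) / η)) * v₂ a ≤ 1 := by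
        rw [mul_div_cancel₀ _ hη.ne', Real.exp_log (h₁ a).pos]
        nlinarith [hv₁₂ a, sq_nonneg (v₁ a - v₂ a), (h₁ a).pos, (h₂ a).pos]
      exact (ih hf h).mono fun b => by linarith

/-- Sublinear regret: the forecaster keeps all gains below `δ * N`, for some `N = O(1 / δ ^ 4)`. -/
theorem exists_predictable_of_not_treeShattered {r : ℕ}
    (hR : ¬ TreeShattered R Set.univ r Set.univ) {δ : ℝ} (hδ : 0 < δ) :
    ∃ N : ℕ, 0 < N ∧ (N : ℝ) ≤ 16 * r ^ 2 / δ ^ 4 + 2 ∧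
      Predictable (relEval R) N (fun _ => -(δ * N)) := by
  have hK : 0 ≤ 16 * (r : ℝ) ^ 2 / δ ^ 4 := by positivity
  refine ⟨⌈16 * (r : ℝ) ^ 2 / δ ^ 4⌉₊ + 1, Nat.succ_pos _, ?_, ?_⟩
  · push_cast
    linarith [Nat.ceil_lt_add_one hK]
  have hN : 16 * (r : ℝ) ^ 2 / δ ^ 4 ≤ ((⌈16 * (r : ℝ) ^ 2 / δ ^ 4⌉₊ + 1 : ℕ) : ℝ) := by
    push_cast
    linarith [Nat.le_ceil (16 * (r : ℝ) ^ 2 / δ ^ 4)]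
  generalize ⌈16 * (r : ℝ) ^ 2 / δ ^ 4⌉₊ + 1 = N at hN
  refine (expBounded_of_not_treeShattered (η := δ) (z := -(δ * N)) hR
    fun _ _ => rfl).predictable hδ ?_
  have hs0 : 0 ≤ √(N : ℝ) := Real.sqrt_nonneg _
  have hss : √(N : ℝ) * √(N : ℝ) = N := Real.mul_self_sqrt (Nat.cast_nonneg _)
  have hcosh : Real.cosh δ ^ N ≤ Real.exp (N * (δ ^ 2 / 2)) := by
    rw [Real.exp_nat_mul]
    exact pow_le_pow_left₀ (Real.cosh_pos _).le (Real.cosh_le_exp_half_sq _) _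
  have hgrow : ((N : ℝ) + 1) ^ r ≤ Real.exp (r * (2 * √(N : ℝ))) := by
    rw [Real.exp_nat_mul]
    refine pow_le_pow_left₀ (by positivity) ?_ _
    have h1 := Real.add_one_le_exp (√(N : ℝ))
    rw [two_mul, Real.exp_add]
    nlinarith
  -- This makes the exponent `-δ²N + δ²N/2 + 2r√N` nonpositive.
  have hroot : 4 * r ≤ δ ^ 2 * √(N : ℝ) := by
    have h1 : 16 * (r : ℝ) ^ 2 ≤ N * δ ^ 4 := by
      rwa [div_le_iff₀ (by positivity)] at hN
    refine le_of_sq_le_sq ?_ (by positivity)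
    calc (4 * (r : ℝ)) ^ 2 = 16 * (r : ℝ) ^ 2 := by ring
      _ ≤ N * δ ^ 4 := h1
      _ = (δ ^ 2 * √(N : ℝ)) ^ 2 := by linear_combination (-δ ^ 4) * hss
  calc _ ≤ Real.exp (δ * -(δ * N)) *
        (Real.exp (N * (δ ^ 2 / 2)) * Real.exp (r * (2 * √(N : ℝ)))) := by gcongr
    _ = Real.exp (δ * -(δ * N) + (N * (δ ^ 2 / 2) + r * (2 * √(N : ℝ)))) := by
      rw [Real.exp_add, Real.exp_add]
    _ ≤ 1 := by
      rw [Real.exp_le_one_iff]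
      have h2 := mul_le_mul_of_nonneg_right hroot hs0
      rw [mul_assoc (δ ^ 2), hss] at h2
      linarith

end

/-! ### The sequential game -/

theorem not_mem_symmetrize {X : Type*} {D : Set (X → Bool)} {d : X → Bool} (hd : d ∈ D) :
    (fun x => !(d x)) ∈ symmetrize D :=
  Or.inr ⟨d, hd, rfl⟩

section

variable {X : Type*} [MeasurableSpace X] {D : Set (X → Bool)} {ε : ℝ}

theorem measurableSet_eq_true {d : X → Bool} (hd : Measurable d) : MeasurableSet {x | d x = true} :=
  hd (measurableSet_singleton true)

theorem distProb_nonneg (p : ProbabilityMeasure X) (d : X → Bool) : 0 ≤ distProb p d :=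
  measureReal_nonneg

theorem distProb_le_one (p : ProbabilityMeasure X) (d : X → Bool) : distProb p d ≤ 1 :=
  measureReal_le_one

theorem distProb_not (p : ProbabilityMeasure X) {d : X → Bool} (hd : Measurable d) :
    distProb p (fun x => !(d x)) = 1 - distProb p d := by
  rw [distProb, distProb, ← probReal_compl_eq_one_sub (measurableSet_eq_true hd)]
  congr 1
  ext x
  simp

theorem measurable_of_mem_symmetrize (hD : ∀ d ∈ D, Measurable d) {s : X → Bool}
    (hs : s ∈ symmetrize D) : Measurable s := by
  rcases hs with hs | ⟨d, hd, rfl⟩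
  · exact hD s hs
  · exact (measurable_of_finite fun y : Bool => !y).comp (hD d hd)

theorem abs_sub_le_ipm (p q : ProbabilityMeasure X) {d : X → Bool} (hd : d ∈ D) :
    |distProb p d - distProb q d| ≤ ipm D p q := by
  refine le_ciSup (f := fun d : D => |distProb p d.1 - distProb q d.1|) ⟨1, ?_⟩ ⟨d, hd⟩
  rintro _ ⟨d, rfl⟩
  rw [abs_le]
  constructor <;> linarith [distProb_nonneg p d.1, distProb_nonneg q d.1, distProb_le_one p d.1,
    distProb_le_one q d.1]

theorem lt_ipm_of_mem_symmetrize (hD : ∀ d ∈ D, Measurable d) {p q : ProbabilityMeasure X}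
    {s : X → Bool} (hs : s ∈ symmetrize D) (h : ε < distProb q s - distProb p s) :
    ε < ipm D p q := by
  rcases hs with hs | ⟨d, hd, rfl⟩
  · linarith [abs_sub_le_ipm p q hs, neg_abs_le (distProb p s - distProb q s)]
  · rw [distProb_not _ (hD d hd), distProb_not _ (hD d hd)] at h
    linarith [abs_sub_le_ipm p q hd, le_abs_self (distProb p d - distProb q d)]

theorem exists_mem_symmetrize_of_lt_ipm (hD : ∀ d ∈ D, Measurable d) (hε : 0 < ε)
    {p q : ProbabilityMeasure X} (h : ε < ipm D p q) :
    ∃ s ∈ symmetrize D, ε < distProb q s - distProb p s := by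
  rcases isEmpty_or_nonempty D with hempty | hne
  · rw [ipm, Real.iSup_of_isEmpty] at h
    exact absurd h hε.not_gt
  · obtain ⟨⟨d, hd⟩, h⟩ := exists_lt_of_lt_ciSup h
    rcases lt_abs.1 h with h | h
    · refine ⟨_, not_mem_symmetrize hd, ?_⟩
      rw [distProb_not _ (hD d hd), distProb_not _ (hD d hd)]
      linarith
    · exact ⟨d, Or.inl hd, by linarith⟩

theorem Discriminator.of_reply_eq_some {A : Discriminator D ε} {preal p : ProbabilityMeasure X}
    {h : List (ProbabilityMeasure X × (X → Bool))} {d : X → Bool}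
    (hd : A.reply preal h p = some d) :
    d ∈ symmetrize D ∧ ε < distProb preal d - distProb p d := by
  rcases le_or_gt (ipm D p preal) ε with hle | hlt
  · rw [A.reply_win preal h p hle] at hd
    cases hd
  · obtain ⟨d', hd', hr, hlt⟩ := A.reply_distinguish preal h p hlt
    rw [hd, Option.some.injEq] at hr
    subst hr
    exact ⟨hd', hlt⟩

theorem generatorWins_succ {G : Generator X} {A : Discriminator D ε}
    {preal : ProbabilityMeasure X} {T : ℕ} {h : List (ProbabilityMeasure X × (X → Bool))} :
    GeneratorWins G A preal (T + 1) h ↔ ∀ d, A.reply preal h (G (h.map Prod.snd)) = some d →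
      GeneratorWins G A preal T (h ++ [(G (h.map Prod.snd), d)]) := by
  rw [GeneratorWins]
  cases A.reply preal h (G (h.map Prod.snd)) <;> simp

theorem GeneratorWins.succ {G : Generator X} {A : Discriminator D ε}
    {preal : ProbabilityMeasure X} {T : ℕ} {h : List (ProbabilityMeasure X × (X → Bool))}
    (hw : GeneratorWins G A preal T h) : GeneratorWins G A preal (T + 1) h := by
  induction T generalizing h with
  | zero => exact hw.elim
  | succ T ih =>
    rw [generatorWins_succ] at hw ⊢
    exact fun d hd => ih (hw d hd)

/-! #### Shattered trees defeat every generator -/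

/-- The replies `l'` reveal, one after the other, a distance of at least `1 / 2` between `x` and
the submissions of `G` after the replies `l`. -/
def Refutes (D : Set (X → Bool)) (G : Generator X) (x : X) :
    List (X → Bool) → List (X → Bool) → Prop
  | _, [] => True
  | l, s :: l' => s ∈ symmetrize D ∧ s x = true ∧ distProb (G l) s ≤ 1 / 2 ∧
      Refutes D G x (l ++ [s]) l'

/-- The generator is deterministic, so the replies and its submissions are determined along the
walk, before the target `x` is picked at the leaf. -/
theorem exists_refutes_of_treeShattered (hD : ∀ d ∈ D, Measurable d) (G : Generator X) {n : ℕ}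
    {C : Set X} (h : TreeShattered (fun (d : D) (x : X) => d.1 x) Set.univ n C)
    (l : List (X → Bool)) : ∃ x ∈ C, ∃ l', l'.length = n ∧ Refutes D G x l l' := by
  induction n generalizing C l with
  | zero =>
    obtain ⟨x, hx⟩ := h
    exact ⟨x, hx, [], rfl, trivial⟩
  | succ n ih =>
    obtain ⟨⟨d, hd⟩, -, h0, h1⟩ := h
    rcases le_total (distProb (G l) d) (1 / 2) with hle | hle
    · obtain ⟨x, ⟨hx, hdx⟩, l', hl', href⟩ := ih h1 (l ++ [d])
      exact ⟨x, hx, d :: l', by simp [hl'], Or.inl hd, hdx, hle, href⟩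
    · obtain ⟨x, ⟨hx, hdx⟩, l', hl', href⟩ := ih h0 (l ++ [fun x => !(d x)])
      refine ⟨x, hx, _ :: l', by simp [hl'], not_mem_symmetrize hd, ?_, ?_, href⟩
      · simpa using hdx
      · rw [distProb_not _ (hD d hd)]
        linarith

open Classical in
/-- The discriminator that gives the replies on the list `l` as long as they are admissible. -/
noncomputable def Discriminator.ofList (hD : ∀ d ∈ D, Measurable d) (hε : 0 < ε)
    (l : List (X → Bool)) : Discriminator D ε where
  reply preal h p :=
    if hp : ε < ipm D p preal then
      if hl : ∃ s ∈ symmetrize D, l[h.length]? = some s ∧ ε < distProb preal s - distProb p s then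
        some hl.choose
      else some (exists_mem_symmetrize_of_lt_ipm hD hε hp).choose
    else none
  reply_win preal h p hp := by
    rw [dif_neg hp.not_gt]
  reply_distinguish preal h p hp := by
    rw [dif_pos hp]
    split_ifs with hl
    · exact ⟨_, hl.choose_spec.1, rfl, hl.choose_spec.2.2⟩
    · exact ⟨_, (exists_mem_symmetrize_of_lt_ipm hD hε hp).choose_spec.1, rfl,
        (exists_mem_symmetrize_of_lt_ipm hD hε hp).choose_spec.2⟩

theorem Discriminator.reply_ofList (hD : ∀ d ∈ D, Measurable d) (hε : 0 < ε)
    {l : List (X → Bool)} {preal p : ProbabilityMeasure X}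
    {h : List (ProbabilityMeasure X × (X → Bool))} {s : X → Bool} (hs : s ∈ symmetrize D)
    (hl : l[h.length]? = some s) (hlt : ε < distProb preal s - distProb p s) :
    (Discriminator.ofList hD hε l).reply preal h p = some s := by
  have hex : ∃ s ∈ symmetrize D, l[h.length]? = some s ∧
    ε < distProb preal s - distProb p s := ⟨s, hs, hl, hlt⟩
  rw [Discriminator.ofList]
  simp only
  rw [dif_pos (lt_ipm_of_mem_symmetrize hD hs hlt), dif_pos hex]
  exact hex.choose_spec.2.1.symm.trans hl

theorem distProb_dirac {s : X → Bool} (hs : Measurable s) {x : X} (hx : s x = true) :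
    distProb ⟨Measure.dirac x, inferInstance⟩ s = 1 := by
  simp [distProb, measureReal_def, Measure.dirac_apply' x (measurableSet_eq_true hs), hx]

theorem Refutes.not_generatorWins (hD : ∀ d ∈ D, Measurable d) (hε : 0 < ε) (hε' : ε < 1 / 2)
    {G : Generator X} {x : X} {l l' : List (X → Bool)}
    {h : List (ProbabilityMeasure X × (X → Bool))} (hl : h.map Prod.snd = l)
    (href : Refutes D G x l l') :
    ¬ GeneratorWins G (Discriminator.ofList hD hε (l ++ l')) ⟨Measure.dirac x, inferInstance⟩
      l'.length h := by
  induction l' generalizing l h with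
  | nil => exact fun hw => hw
  | cons s l' ih =>
    obtain ⟨hs, hsx, hG, href⟩ := href
    intro hw
    have hrep := Discriminator.reply_ofList hD hε (l := l ++ s :: l') (h := h)
      (p := G (h.map Prod.snd)) (preal := ⟨Measure.dirac x, inferInstance⟩) hs
      (by simp [← hl]) (by
        rw [distProb_dirac (measurable_of_mem_symmetrize hD hs) hsx, hl]
        linarith)
    have := generatorWins_succ.1 hw s hrep
    have hih := ih (l := l ++ [s]) (h := h ++ [(G (h.map Prod.snd), s)]) (by simp [hl]) href
    rw [List.append_assoc, List.singleton_append] at hih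
    exact hih this

theorem dualLittlestoneDim_lt_top_of_epsSequentialFoolable (hD : ∀ d ∈ D, Measurable d)
    (hε : 0 < ε) (hε' : ε < 1 / 2) (h : EpsSequentialFoolable D ε) :
    dualLittlestoneDim D < ⊤ := by
  obtain ⟨T, G, hG⟩ := h
  rw [dualLittlestoneDim_lt_top_iff]
  refine ⟨T, fun hT => ?_⟩
  obtain ⟨x, -, l, rfl, href⟩ := exists_refutes_of_treeShattered hD G hT []
  exact href.not_generatorWins hD hε hε' (h := []) rfl (hG _ _)

/-! #### Forecasters yield generators -/

/-- With `k` rounds left, the generator wins for every target distribution for which the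
expectation of `c` is positive. -/
def GeneratorForces (D : Set (X → Bool)) (ε : ℝ) : ℕ → (X → ℝ) → Prop
  | 0, c => ∀ x, c x ≤ 0
  | k + 1, c => GeneratorForces D ε k c ∨ ∃ p : ProbabilityMeasure X, ∀ s ∈ symmetrize D,
      GeneratorForces D ε k (fun x => c x + ((if s x then 1 else 0) - distProb p s) - ε)

theorem GeneratorForces.mono {k : ℕ} {c c' : X → ℝ} (hc : ∀ x, c' x ≤ c x)
    (h : GeneratorForces D ε k c) : GeneratorForces D ε k c' := by
  induction k generalizing c c' with
  | zero => exact fun x => (hc x).trans (h x)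
  | succ k ih =>
    rcases h with h | ⟨p, hp⟩
    · exact Or.inl (ih hc h)
    · exact Or.inr ⟨p, fun s hs => ih (fun x => by linarith [hc x]) (hp s hs)⟩

theorem integrable_ite (p : ProbabilityMeasure X) {s : X → Bool} (hs : Measurable s) :
    Integrable (fun x => if s x then (1 : ℝ) else 0) p := by
  refine Integrable.of_bound (C := 1) (Measurable.aestronglyMeasurable ?_) (ae_of_all _ fun x => ?_)
  · exact measurable_const.ite (measurableSet_eq_true hs) measurable_const
  · split_ifs <;> simp

theorem integral_ite (p : ProbabilityMeasure X) {s : X → Bool} (hs : Measurable s) :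
    ∫ x, (if s x then (1 : ℝ) else 0) ∂p = distProb p s := by
  rw [distProb, ← integral_indicator_one (measurableSet_eq_true hs)]
  simp only [Set.indicator_apply, Set.mem_ofPred_eq, Pi.one_apply]

/-- An admissible reply has gap above ε, so the expectation of `c` under the target stays positive,
which is impossible once `c ≤ 0`. Quantifying over `G'` allows the strategies after each first reply
to be glued. -/
theorem GeneratorForces.exists_generator [Nonempty X] (hD : ∀ d ∈ D, Measurable d) {k : ℕ}
    {c : X → ℝ} (h : GeneratorForces D ε k c) :
    ∃ G : Generator X, ∀ (A : Discriminator D ε) (preal : ProbabilityMeasure X),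
      Integrable c preal → 0 < ∫ x, c x ∂preal →
      ∀ (G' : Generator X) (hist : List (ProbabilityMeasure X × (X → Bool))),
        (∀ l, G' (hist.map Prod.snd ++ l) = G l) → GeneratorWins G' A preal k hist := by
  classical
  have : Nonempty (Generator X) :=
    ⟨fun _ => ⟨Measure.dirac (Classical.arbitrary X), inferInstance⟩⟩
  induction k generalizing c with
  | zero =>
    refine ⟨fun _ => ⟨Measure.dirac (Classical.arbitrary X), inferInstance⟩,
      fun A preal _ hpos => ?_⟩
    exact absurd hpos (integral_nonpos h).not_gt
  | succ k ih =>
    rcases h with h | ⟨p, hp⟩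
    · obtain ⟨G, hG⟩ := ih h
      exact ⟨G, fun A preal hi hpos G' hist hG' => (hG A preal hi hpos G' hist hG').succ⟩
    · choose! Gs hGs using fun s (hs : s ∈ symmetrize D) => ih (hp s hs)
      refine ⟨fun l => match l with
        | [] => p
        | s :: l => Gs s l, fun A preal hi hpos G' hist hG' => ?_⟩
      rw [generatorWins_succ]
      have hp' : G' (hist.map Prod.snd) = p := by simpa using hG' []
      rw [hp']
      intro s hs
      obtain ⟨hsD, hlt⟩ := Discriminator.of_reply_eq_some hs
      have hsm := measurable_of_mem_symmetrize hD hsD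
      have hi1 := integrable_ite preal hsm
      have hi2 : Integrable (fun x => (if s x then (1 : ℝ) else 0) - distProb p s) preal :=
        hi1.sub (integrable_const _)
      have hi3 : Integrable (fun x => c x + ((if s x then (1 : ℝ) else 0) - distProb p s)) preal :=
        hi.add hi2
      refine hGs s hsD A preal (hi3.sub (integrable_const ε)) ?_ G' _ fun l => ?_
      · rw [integral_sub hi3 (integrable_const ε), integral_add hi hi2,
          integral_sub hi1 (integrable_const _), integral_ite preal hsm]
        simp only [integral_const, probReal_univ, one_smul]
        linarith
      · simpa using hG' (s :: l)

theorem exists_probabilityMeasure_of_mem_convexHull (hD : ∀ d ∈ D, Measurable d) {g : D → ℝ}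
    (hg : g ∈ convexHull ℝ (Set.range (relEval fun (d : D) (x : X) => d.1 x))) :
    ∃ p : ProbabilityMeasure X, ∀ d : D, distProb p d.1 = g d := by
  refine convexHull_min (t := {g : D → ℝ | ∃ p : ProbabilityMeasure X,
    ∀ d : D, distProb p d.1 = g d}) ?_ ?_ hg
  · rintro _ ⟨x, rfl⟩
    refine ⟨⟨Measure.dirac x, inferInstance⟩, fun d => ?_⟩
    cases hx : d.1 x
    · simp [distProb, relEval, measureReal_def,
        Measure.dirac_apply' x (measurableSet_eq_true (hD d.1 d.2)), hx]
    · simp [distProb_dirac (hD d.1 d.2) hx, relEval, hx]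
  · rintro g ⟨p, hp⟩ g' ⟨p', hp'⟩ s t hs ht hst
    refine ⟨⟨ENNReal.ofReal s • (p : Measure X) + ENNReal.ofReal t • (p' : Measure X), ⟨?_⟩⟩,
      fun d => ?_⟩
    · simp [← ENNReal.ofReal_add hs ht, hst]
    · simp only [distProb] at hp hp'
      simp only [distProb, ProbabilityMeasure.coe_mk, Pi.add_apply, Pi.smul_apply, smul_eq_mul]
      rw [measureReal_add_apply (ENNReal.mul_ne_top ENNReal.ofReal_ne_top (measure_ne_top _ _))
        (ENNReal.mul_ne_top ENNReal.ofReal_ne_top (measure_ne_top _ _)),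
        measureReal_ennreal_smul_apply, measureReal_ennreal_smul_apply,
        hp, hp', ENNReal.toReal_ofReal hs, ENNReal.toReal_ofReal ht]

theorem Predictable.generatorForces [Nonempty X] (hD : ∀ d ∈ D, Measurable d) (hne : D.Nonempty)
    (hε : 0 < ε) {m : ℕ} (hm : 0 < m)
    (h : Predictable (relEval fun (d : D) (x : X) => d.1 x) m (fun _ => -(ε / 16 * m))) {k : ℕ}
    {c : X → ℝ} (hc : Predictable (relEval fun (d : D) (x : X) => d.1 x) k c) :
    GeneratorForces D ε k (fun x => c x + k * (ε / 4)) := by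
  have : Nonempty D := hne.to_subtype
  induction k generalizing c with
  | zero =>
    intro x
    simpa using hc x
  | succ k ih =>
    push_cast
    obtain ⟨f, hf⟩ := hc.exists_forall_signedMixtures
    -- Here `α + γ = ε/2` leaves a gap of at least ε/2 after a reply, and `α - γ = ε/4` is the
    -- credit per round; the regret rate ε/16 lies below `γ`.
    rcases h.exists_close_or_exists_separating hm (α := 3 * ε / 8) (γ := ε / 8) (by linarith) f
      with ⟨g, hg, hgf⟩ | ⟨q, hq, hqf⟩
    · obtain ⟨p, hp⟩ := exists_probabilityMeasure_of_mem_convexHull hD hg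
      refine Or.inr ⟨p, ?_⟩
      rintro s (hs | ⟨d, hd, rfl⟩)
      · refine (ih (hf (LinearMap.proj ⟨s, hs⟩)
          (subset_convexHull ℝ _ ⟨_, Or.inl rfl⟩)).1).mono fun x => ?_
        have := (abs_le.1 (hgf ⟨s, hs⟩)).1
        have := hp ⟨s, hs⟩
        simp only [LinearMap.proj_apply, relEval]
        linarith
      · refine (ih (hf (LinearMap.proj ⟨d, hd⟩)
          (subset_convexHull ℝ _ ⟨_, Or.inl rfl⟩)).2).mono fun x => ?_
        have := (abs_le.1 (hgf ⟨d, hd⟩)).2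
        have := hp ⟨d, hd⟩
        rw [distProb_not p (hD d hd)]
        simp only [LinearMap.proj_apply, relEval]
        rcases Bool.eq_false_or_eq_true (d x) with hx | hx <;> simp only [hx] <;> norm_num <;>
          linarith
    -- The forecaster uses up a round but the generator submits nothing.
    · refine Or.inl ((ih (hf q hq).1).mono fun x => ?_)
      linarith [hqf x]

theorem sequentialFoolableWithin_one_of_empty [Nonempty X] :
    SequentialFoolableWithin (∅ : Set (X → Bool)) ε 1 := by
  refine ⟨fun _ => ⟨Measure.dirac (Classical.arbitrary X), inferInstance⟩, fun A preal => ?_⟩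
  refine generatorWins_succ.2 fun d hd => ?_
  simpa [symmetrize] using (Discriminator.of_reply_eq_some hd).1

theorem sequentialFoolable_of_dualLittlestoneDim_lt_top [Nonempty X] (hD : ∀ d ∈ D, Measurable d)
    (h : dualLittlestoneDim D < ⊤) : SequentialFoolable D := by
  obtain ⟨r, hr⟩ := (dualLittlestoneDim_lt_top_iff D).1 h
  refine ⟨Polynomial.C (16 * (r : ℝ) ^ 2 * 16 ^ 4) * Polynomial.X ^ 4 + Polynomial.C 2,
    fun ε hε => ?_⟩
  simp only [Polynomial.eval_add, Polynomial.eval_mul, Polynomial.eval_C, Polynomial.eval_pow,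
    Polynomial.eval_X]
  -- For empty `D` no reply is admissible, so any submission wins; the minimax step needs a
  -- discriminator.
  rcases D.eq_empty_or_nonempty with rfl | hne
  · refine ⟨1, ?_, sequentialFoolableWithin_one_of_empty⟩
    have : 0 ≤ 16 * (r : ℝ) ^ 2 * 16 ^ 4 * (1 / ε) ^ 4 := by positivity
    push_cast
    linarith
  obtain ⟨N, hN, hle, hpred⟩ := exists_predictable_of_not_treeShattered hr
    (div_pos hε (by norm_num : (0 : ℝ) < 16))
  refine ⟨N, hle.trans (le_of_eq (by field_simp)), ?_⟩
  obtain ⟨G, hG⟩ := (hpred.generatorForces hD hne hε hN hpred).exists_generator hD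
  refine ⟨G, fun A preal => hG A preal (integrable_const _) ?_ G [] fun l => rfl⟩
  have hN' : (0 : ℝ) < N := by exact_mod_cast hN
  simp only [integral_const, probReal_univ, one_smul]
  nlinarith

end

theorem corollary3 {X : Type*} [MeasurableSpace X] [Nonempty X]
    (D : Set (X → Bool)) (hD : ∀ d ∈ D, Measurable d) :
    List.TFAE
      [SequentialFoolable D,
       ∃ ε : ℝ, 0 < ε ∧ ε < 1 / 2 ∧ EpsSequentialFoolable D ε,
       dualLittlestoneDim D < ⊤,
       littlestoneDim D < ⊤] := by
  tfae_have 1 → 2 := by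
    rintro ⟨P, hP⟩
    obtain ⟨T, -, hT⟩ := hP (1 / 4) (by norm_num)
    exact ⟨1 / 4, by norm_num, by norm_num, T, hT⟩
  tfae_have 2 → 3 := by
    rintro ⟨ε, hε, hε', h⟩
    exact dualLittlestoneDim_lt_top_of_epsSequentialFoolable hD hε hε' h
  tfae_have 3 → 1 := sequentialFoolable_of_dualLittlestoneDim_lt_top hD
  tfae_have 3 ↔ 4 := dualLittlestoneDim_lt_top_iff_littlestoneDim_lt_top D
  tfae_finish
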